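/- **Setting.** Let $\mathcal X$ be a measurable space with a nonzero reference measure, and let $p(x\mid\theta)=\exp\{\langle t(x),\theta\rangle-\psi(\theta)-h(x)\}$ be an exponential family on $\mathcal X$ with measurable $t:\mathcal X\to\mathbb R^d$ and $h:\mathcal X\to\mathbb R$. Here $\Theta\subseteq\mathbb R^d$ is the natural parameter space (the set of all $\theta$ at which $\exp\{\langle t(x),\theta\rangle-h(x)\}$ is integrable) and $\psi$ is the log-partition function. The family is regular ($\Theta$ is open and nonempty) and minimal (for no $a\neq0$ is $\langle a,t(x)\rangle$ constant in $x$). Let $\varphi(\mu)=\sup_{\theta\in\Theta}\{\langle\mu,\theta\rangle-\psi(\theta)\}$. Let $\nu\in\mathbb R$, $\tau\in\mathbb R^d$ be such that the conjugate prior $\exp\{\langle\tau,\theta\rangle-\nu\psi(\theta)-\xi(\nu,\tau)\}$ is proper on $\Theta$, with $\xi(\nu,\tau)$ its log-normalizer. For a scale $\beta>0$ put $\tilde\theta=\beta\theta$ and $\tilde\psi(\tilde\theta)=\beta\psi(\tilde\theta/\beta)$. The scaled likelihood is $p(x\mid\tilde\theta)=\exp\{\langle t(x),\tilde\theta\rangle-\tilde\psi(\tilde\theta)-h_\beta(x)\}$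 (the claims hold for every real-valued $h_\beta$), and the scaled prior is $p(\tilde\theta)=\exp\{\langle\tilde\theta,\tau/\beta\rangle-(\nu/\beta)\tilde\psi(\tilde\theta)-\xi(\nu,\tau)\}$ on $\beta\Theta$. Let $x_1,\dots,x_n\in\mathcal X$ be data with $\varphi(t(x_i))<\infty$ for all $i$. For a nonempty $c\subseteq\{1,\dots,n\}$ put $\bar t_c=\frac1{|c|}\sum_{i\in c}t(x_i)$ and $$p(X_c\mid H_c)=\int_{\beta\Theta}\Big\{\prod_{i\in c}p(x_i\mid\tilde\theta)\Big\}\,p(\tilde\theta)\,d\tilde\theta .$$ Trees are binary, with distinct leaves labelled by data indices, and the cluster $c$ of a tree $T_c$ is the set of its leaf labels. Put $\gamma_{\{i\}}=\alpha$ and $p(X_{\{i\}}\mid T_{\{i\}})=p(X_{\{i\}}\mid H_{\{i\}})$ for leaves. If $T_c$ has the root subtrees $T_{c_0},T_{c_1}$, put $\gamma_c=\alpha\Gamma(|c|)+\gamma_{c_0}\gamma_{c_1}$, $p(H_c)=\alpha\Gamma(|c|)/\gamma_c$ and $$p(X_c\mid T_c)=p(H_c)p(X_c\mid H_c)+(1-p(H_c))\,p(X_{c_0}\mid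 T_{c_0})\,p(X_{c_1}\mid T_{c_1}).$$ For trees with disjoint clusters $c_0,c_1$ and $c=c_0\cup c_1$, the dissimilarity of Bayesian hierarchical clustering (BHC) is $$d(c_0,c_1)=\frac{\gamma_{c_0}p(X_{c_0}\mid T_{c_0})\;\gamma_{c_1}p(X_{c_1}\mid T_{c_1})}{\alpha\,\Gamma(|c|)\,p(X_c\mid H_c)},\qquad \alpha=\beta^{-d/2}e^{-\beta\lambda},$$ where $\lambda\in\mathbb R$ is fixed. Put $$d_\star(c_0,c_1)=|c_0|\varphi(\bar t_{c_0})+|c_1|\varphi(\bar t_{c_1})-|c|\varphi(\bar t_c).$$ Say that a tree satisfies condition (C) if it is a single leaf, or if the dissimilarity of its two root subtrees tends to $0$ as $\beta\to\infty$. **Claims.** 1. Let $T_{c_0},T_{c_1}$ be trees with disjoint clusters. If both satisfy (C) and $d_\star(c_0,c_1)<\lambda$, then $d(c_0,c_1)\to0$ as $\beta\to\infty$. If $d_\star(c_0,c_1)>\lambda$, then $d(c_0,c_1)\to\infty$, whether or not (C) holds. 2. A tree satisfies (C) if $d_\star<\lambda$ for the pair of clusters merged at each of its internal nodes. 3. Let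 $T_{c_0},T_{c_1}$ have disjoint clusters, let $T_{c_2},T_{c_3}$ have disjoint clusters, and let all four trees satisfy (C). As $\beta\to\infty$, $d(c_0,c_1)/d(c_2,c_3)$ tends to $0$ if $d_\star(c_0,c_1)<d_\star(c_2,c_3)$, and to $\infty$ if $d_\star(c_0,c_1)>d_\star(c_2,c_3)$. 4. Greedy agglomeration with a dissimilarity $D$ and a threshold $s$ starts with the $n$ single leaves, repeatedly merges a pair of current trees with minimal $D$, and stops when this minimum exceeds $s$ or only at most one tree is left. BHC is this algorithm with $D=d$ and $s=1$; call it the $d_\star$-algorithm for $D=d_\star$ and $s=\lambda$. Suppose that in no state of any run of the $d_\star$-algorithm the minimal $d_\star$ equals $\lambda$. Then for all sufficiently large $\beta$ every state of a BHC run is a state of a run of the $d_\star$-algorithm, and every output of BHC is an output of the $d_\star$-algorithm. If moreover the minimizing pair is unique (up to order) in every such state in which the minimum is at most $\lambda$, then for all sufficiently large $\beta$ the two algorithms have exactly the same states and the same outputs. -/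

import Mathlib

open scoped Pointwise

namespace BHC

noncomputable section

/-- A regular minimal exponential family on a sample space `𝒳`, with reference measure `ref`,
sufficient statistic `t` and densities `exp (⟪t x, θ⟫ - ψ θ - h x)`; the log-partition function `ψ`
and the natural parameter space `Θ` are determined by these data, see below. -/
structure ExpFamily (𝒳 : Type*) [MeasurableSpace 𝒳] (d : ℕ) where
  ref : MeasureTheory.Measure 𝒳
  ref_ne_zero : ref ≠ 0
  t : 𝒳 → EuclideanSpace ℝ (Fin d)
  measurable_t : Measurable t
  h : 𝒳 → ℝ
  measurable_h : Measurable h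
  nonempty : ∃ θ, MeasureTheory.Integrable (fun x => Real.exp (inner ℝ (t x) θ - h x)) ref
  /-- regularity: the natural parameter space is open -/
  regular :
    IsOpen {θ | MeasureTheory.Integrable (fun x => Real.exp (inner ℝ (t x) θ - h x)) ref}
  /-- minimality: no nontrivial linear functional of the sufficient statistic is constant -/
  minimal : ∀ a : EuclideanSpace ℝ (Fin d), a ≠ 0 → ¬ ∃ k : ℝ, ∀ x, inner ℝ a (t x) = k

namespace ExpFamily

variable {𝒳 : Type*} [MeasurableSpace 𝒳] {d : ℕ}

/-- The natural parameter space. -/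
def Θ (E : ExpFamily 𝒳 d) : Set (EuclideanSpace ℝ (Fin d)) :=
  {θ | MeasureTheory.Integrable (fun x => Real.exp (inner ℝ (E.t x) θ - E.h x)) E.ref}

/-- The log-partition function. -/
def ψ (E : ExpFamily 𝒳 d) (θ : EuclideanSpace ℝ (Fin d)) : ℝ :=
  Real.log (∫ x, Real.exp (inner ℝ (E.t x) θ - E.h x) ∂E.ref)

/-- The effective domain of the convex conjugate of `ψ`, where the supremum is finite. -/
def domφ (E : ExpFamily 𝒳 d) : Set (EuclideanSpace ℝ (Fin d)) :=
  {μ | BddAbove ((fun θ => inner ℝ μ θ - E.ψ θ) '' E.Θ)}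

/-- The convex conjugate `φ μ = sup_{θ ∈ Θ} (⟪μ, θ⟫ - ψ θ)` (meaningful on `domφ`). -/
def φ (E : ExpFamily 𝒳 d) (μ : EuclideanSpace ℝ (Fin d)) : ℝ :=
  sSup ((fun θ => inner ℝ μ θ - E.ψ θ) '' E.Θ)

/-- The scaled log-partition function `ψ̃ θ̃ = β ψ (θ̃ / β)`. -/
def scaledψ (E : ExpFamily 𝒳 d) (β : ℝ) (θ' : EuclideanSpace ℝ (Fin d)) : ℝ :=
  β * E.ψ (β⁻¹ • θ')

/-- The scaled density `p(x | θ̃) = exp (⟪t x, θ̃⟫ - ψ̃ θ̃ - h_β x)`. -/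
def scaledDensity (E : ExpFamily 𝒳 d) (hs : ℝ → 𝒳 → ℝ) (β : ℝ) (x : 𝒳)
    (θ' : EuclideanSpace ℝ (Fin d)) : ℝ :=
  Real.exp (inner ℝ (E.t x) θ' - E.scaledψ β θ' - hs β x)

/-- Hyperparameters `ν`, `τ` of a proper conjugate prior. -/
structure ConjPrior (E : ExpFamily 𝒳 d) where
  ν : ℝ
  τ : EuclideanSpace ℝ (Fin d)
  proper : MeasureTheory.IntegrableOn (fun θ => Real.exp (inner ℝ τ θ - ν * E.ψ θ)) E.Θ

/-- The log-normalizer of the conjugate prior. -/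
def ConjPrior.ξ {E : ExpFamily 𝒳 d} (P : E.ConjPrior) : ℝ :=
  Real.log (∫ θ in E.Θ, Real.exp (inner ℝ P.τ θ - P.ν * E.ψ θ))

/-- The scaled conjugate prior `p(θ̃ | ν/β, τ/β)`: for `θ̃ = β θ` its value is
`exp (⟪θ, τ⟫ - ν ψ θ - ξ(ν, τ))`. -/
def ConjPrior.scaledDensity {E : ExpFamily 𝒳 d} (P : E.ConjPrior) (β : ℝ)
    (θ' : EuclideanSpace ℝ (Fin d)) : ℝ :=
  Real.exp (inner ℝ θ' (β⁻¹ • P.τ) - (P.ν / β) * E.scaledψ β θ' - P.ξ)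

end ExpFamily

/-- Binary trees whose leaves carry data indices. -/
inductive ClusterTree (n : ℕ) : Type
  | leaf : Fin n → ClusterTree n
  | node : ClusterTree n → ClusterTree n → ClusterTree n

namespace ClusterTree

variable {n : ℕ}

/-- The cluster of a tree: the set of the indices at its leaves. -/
def cluster : ClusterTree n → Finset (Fin n)
  | leaf i => {i}
  | node l r => cluster l ∪ cluster r

/-- The two subtrees of every node have disjoint clusters. -/
def Valid : ClusterTree n → Prop
  | leaf _ => True
  | node l r => Valid l ∧ Valid r ∧ Disjoint l.cluster r.cluster

/-- `p` holds for the two clusters that are merged at each internal node. -/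
def AllMerges (p : Finset (Fin n) → Finset (Fin n) → Prop) : ClusterTree n → Prop
  | leaf _ => True
  | node l r => AllMerges p l ∧ AllMerges p r ∧ p l.cluster r.cluster

/-- `γ_{i} = α` and `γ_c = α Γ(|c|) + γ_{c₀} γ_{c₁}`. -/
def gam (α : ℝ) : ClusterTree n → ℝ
  | leaf _ => α
  | node l r => α * Real.Gamma ((cluster l ∪ cluster r).card) + gam α l * gam α r

/-- The prior probability `p(H_c) = α Γ(|c|) / γ_c` of a single cluster. -/
def priorProb (α : ℝ) (T : ClusterTree n) : ℝ :=
  α * Real.Gamma T.cluster.card / T.gam α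

end ClusterTree

open ClusterTree

variable {𝒳 : Type*} [MeasurableSpace 𝒳] {d n : ℕ}

section Model

variable (E : ExpFamily 𝒳 d) (P : E.ConjPrior) (hs : ℝ → 𝒳 → ℝ) (X : Fin n → 𝒳)

/-- The marginal likelihood `p(X_c | H_c)` at scale `β`: the integral, over the scaled parameter
`θ̃ ∈ β Θ`, of the likelihood of the points of `c` against the scaled conjugate prior. -/
def marginal (β : ℝ) (c : Finset (Fin n)) : ℝ :=
  ∫ θ' in β • E.Θ, (∏ i ∈ c, E.scaledDensity hs β (X i) θ') * P.scaledDensity β θ'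

/-- The tree likelihood `p(X_c | T_c)`. -/
def treeLik (α β : ℝ) : ClusterTree n → ℝ
  | leaf i => marginal E P hs X β {i}
  | node l r =>
      (node l r).priorProb α * marginal E P hs X β (l.cluster ∪ r.cluster) +
        (1 - (node l r).priorProb α) * (treeLik α β l * treeLik α β r)

/-- The potential `φ(X_c | H_c) = α Γ(|c|) p(X_c | H_c)`. -/
def potH (α β : ℝ) (c : Finset (Fin n)) : ℝ :=
  α * Real.Gamma c.card * marginal E P hs X β c

/-- The potential `φ(X_c | T_c) = γ_c p(X_c | T_c)`. -/
def potT (α β : ℝ) (T : ClusterTree n) : ℝ :=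
  T.gam α * treeLik E P hs X α β T

/-- The dissimilarity of Bayesian hierarchical clustering for two trees, for general `α`. -/
def dissimOf (α β : ℝ) (T₀ T₁ : ClusterTree n) : ℝ :=
  potT E P hs X α β T₀ * potT E P hs X α β T₁ /
    potH E P hs X α β (T₀.cluster ∪ T₁.cluster)

/-- The concentration `α = β^{-d/2} e^{-βλ}`. -/
def conc (d : ℕ) (lam β : ℝ) : ℝ := β ^ (-((d : ℝ) / 2)) * Real.exp (-(β * lam))

/-- The dissimilarity at scale `β`, with `α = β^{-d/2} e^{-βλ}`. -/
def dissim (lam β : ℝ) (T₀ T₁ : ClusterTree n) : ℝ :=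
  dissimOf E P hs X (conc d lam β) β T₀ T₁

/-- The dissimilarity of the two children of the root of a tree; zero for a single leaf, where
there are no children. -/
def childDissim (lam β : ℝ) : ClusterTree n → ℝ
  | leaf _ => 0
  | node l r => dissim E P hs X lam β l r

/-- The average sufficient statistic of a cluster. -/
def tbar (c : Finset (Fin n)) : EuclideanSpace ℝ (Fin d) :=
  (c.card : ℝ)⁻¹ • ∑ i ∈ c, E.t (X i)

/-- `d⋆(c₀, c₁) = |c₀| φ(t̄_{c₀}) + |c₁| φ(t̄_{c₁}) - |c| φ(t̄_c)` with `c = c₀ ∪ c₁`. -/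
def dStar (c₀ c₁ : Finset (Fin n)) : ℝ :=
  c₀.card * E.φ (tbar E X c₀) + c₁.card * E.φ (tbar E X c₁) -
    (c₀ ∪ c₁).card * E.φ (tbar E X (c₀ ∪ c₁))

/-- `d⋆` for the clusters of two trees. -/
def dStarTree (T₀ T₁ : ClusterTree n) : ℝ := dStar E X T₀.cluster T₁.cluster

end Model

/-! Greedy agglomeration. A state is the set of the current trees. -/

/-- `T₀ ≠ T₁` are two trees of the state `F` whose dissimilarity `D` is minimal. -/
def IsClosestPair (D : ClusterTree n → ClusterTree n → ℝ) (F : Set (ClusterTree n))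
    (T₀ T₁ : ClusterTree n) : Prop :=
  T₀ ∈ F ∧ T₁ ∈ F ∧ T₀ ≠ T₁ ∧ ∀ S₀ ∈ F, ∀ S₁ ∈ F, S₀ ≠ S₁ → D T₀ T₁ ≤ D S₀ S₁

/-- One step: a closest pair is merged, unless its dissimilarity exceeds the threshold. -/
def GreedyStep (D : ClusterTree n → ClusterTree n → ℝ) (thr : ℝ)
    (F F' : Set (ClusterTree n)) : Prop :=
  ∃ T₀ T₁, IsClosestPair D F T₀ T₁ ∧ D T₀ T₁ ≤ thr ∧ F' = insert (node T₀ T₁) (F \ {T₀, T₁})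

/-- `F` occurs in a run of the greedy algorithm started at the single leaves. -/
def GreedyReach (D : ClusterTree n → ClusterTree n → ℝ) (thr : ℝ)
    (F : Set (ClusterTree n)) : Prop :=
  Relation.ReflTransGen (GreedyStep D thr) (Set.range leaf) F

/-- `F` is a possible output: it occurs in a run, and the algorithm stops there. -/
def GreedyOutput (D : ClusterTree n → ClusterTree n → ℝ) (thr : ℝ)
    (F : Set (ClusterTree n)) : Prop :=
  GreedyReach D thr F ∧ ∀ F', ¬ GreedyStep D thr F F'

end

end BHC

/-!
Only exponential rates in `β` matter. The substitution `θ̃ = β θ` turns `p(X_c | H_c)` into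
`β ^ d * exp (-∑ i ∈ c, h_β (x i) - ξ)` times the integral over `Θ` of
`exp (|c| β (⟪t̄_c, θ⟫ - ψ θ))` against an integrable positive weight (`marginal_eq`). By the Laplace
principle (`tendsto_log_setIntegral_exp_div`), that integral grows like `exp (β |c| φ (t̄_c))` up to
subexponential factors. The supremum defining `φ` may fail to be attained, and no second-order
expansion is needed; continuity of `ψ` follows from convexity of the partition function.
With `α = β^{-d/2} e^{-βλ}`, the potential `φ(X_c | H_c)` has rate `|c| φ (t̄_c) - λ`, apart from the
terms `h_β (x i)` (`tendsto_log_potH`).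

In potentials, the tree recursion reads
`φ(X_c | T_c) = φ(X_c | H_c) + φ(X_{c₀} | T_{c₀}) φ(X_{c₁} | T_{c₁}) = φ(X_c | H_c) (1 + d(c₀, c₁))`.
So `φ(X_c | T_c)` has the rate of `φ(X_c | H_c)` as soon as the dissimilarity of the root subtrees
vanishes, and it is never smaller than `φ(X_c | H_c)`. Three rates combine to
`log d(c₀, c₁) / β → d⋆(c₀, c₁) - λ` (`tendsto_log_dissim`), where the terms `h_β (x i)` cancel because
the clusters are disjoint. This gives the dichotomy, the comparison, and by induction on the tree
the vanishing below the threshold.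

For the greedy algorithm, every merge in a `d⋆`-run has `d⋆ < λ` when ties with `λ` are excluded.
There are only finitely many valid trees, so beyond one `β` the dissimilarity respects every strict
inequality of `d⋆` on all forests concerned (`eventually_refines`). A `d`-minimal pair is then also
`d⋆`-minimal and lies on the same side of the threshold, and the statements about runs and outputs
follow by induction along a run.
-/

namespace BHC

open MeasureTheory Filter Topology

/-! ### The Laplace principle on the exponential scale -/

section Laplace

variable {Y : Type*} [TopologicalSpace Y] [MeasurableSpace Y] [OpensMeasurableSpace Y]
  {μ : Measure Y} {S : Set Y} {g w : Y → ℝ}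

theorem setIntegral_pos_of_isOpen [μ.IsOpenPosMeasure] (hS : IsOpen S) (hne : S.Nonempty)
    (hw : IntegrableOn w S μ) (hpos : ∀ y ∈ S, 0 < w y) : 0 < ∫ y in S, w y ∂μ := by
  rw [setIntegral_pos_iff_support_of_nonneg_ae
    (ae_restrict_of_forall_mem hS.measurableSet fun y hy => (hpos y hy).le) hw]
  have : Function.support w ∩ S = S :=
    Set.inter_eq_right.2 fun y hy => (hpos y hy).ne'
  rw [this]
  exact hS.measure_pos μ hne

theorem integrableOn_exp_mul (hS : IsOpen S) (hg : ContinuousOn g S) (hb : BddAbove (g '' S))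
    (hw : IntegrableOn w S μ) {b : ℝ} (hb0 : 0 ≤ b) :
    IntegrableOn (fun y => Real.exp (b * g y) * w y) S μ := by
  obtain ⟨K, hK⟩ := hb
  refine Integrable.bdd_mul (c := Real.exp (b * K)) hw ?_ ?_
  · exact ContinuousOn.aestronglyMeasurable (by fun_prop) hS.measurableSet
  · refine ae_restrict_of_forall_mem hS.measurableSet fun y hy => ?_
    rw [Real.norm_eq_abs, Real.abs_exp]
    exact Real.exp_le_exp.2 (mul_le_mul_of_nonneg_left (hK ⟨y, hy, rfl⟩) hb0)

/-- The maximum of `g` need not be attained: only the exponential rate of the integral is claimed,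
and for this it suffices that every superlevel set of `g` below the supremum has positive
measure. -/
theorem tendsto_log_setIntegral_exp_div [μ.IsOpenPosMeasure] (hS : IsOpen S) (hne : S.Nonempty)
    (hg : ContinuousOn g S) (hb : BddAbove (g '' S)) (hw : IntegrableOn w S μ)
    (hpos : ∀ y ∈ S, 0 < w y) :
    Tendsto (fun b : ℝ => Real.log (∫ y in S, Real.exp (b * g y) * w y ∂μ) / b) atTop
      (𝓝 (sSup (g '' S))) := by
  have hI : ∀ b : ℝ, 0 ≤ b → IntegrableOn (fun y => Real.exp (b * g y) * w y) S μ :=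
    fun b hb0 => integrableOn_exp_mul hS hg hb hw hb0
  have hIpos : ∀ b : ℝ, 0 ≤ b → 0 < ∫ y in S, Real.exp (b * g y) * w y ∂μ := fun b hb0 =>
    setIntegral_pos_of_isOpen hS hne (hI b hb0) fun y hy => mul_pos (Real.exp_pos _) (hpos y hy)
  have hvan : ∀ a k : ℝ, Tendsto (fun b : ℝ => a + k / b) atTop (𝓝 a) := fun a k => by
    simpa using (tendsto_const_nhds (x := a)).add (tendsto_id.const_div_atTop k)
  refine tendsto_order.2 ⟨fun a' ha' => ?_, fun a' ha' => ?_⟩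
  -- lower bound: restriction of the integral to the superlevel set `{g > a}`, for `a' < a < sup g`
  · obtain ⟨a, haa', haK⟩ := exists_between ha'
    obtain ⟨_, ⟨y, hy, rfl⟩, hay⟩ := exists_lt_of_lt_csSup (hne.image g) haK
    set U : Set Y := S ∩ g ⁻¹' Set.Ioi a
    have hU : IsOpen U := hg.isOpen_inter_preimage hS isOpen_Ioi
    have hUS : U ⊆ S := Set.inter_subset_left
    have hWU : 0 < ∫ y in U, w y ∂μ :=
      setIntegral_pos_of_isOpen hU ⟨y, hy, hay⟩ (hw.mono_set hUS) fun y hy => hpos y (hUS hy)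
    filter_upwards [(tendsto_order.1 (hvan a (Real.log (∫ y in U, w y ∂μ)))).1 a' haa',
      eventually_gt_atTop 0] with b hlt hb0
    refine hlt.trans_le ?_
    have h1 : Real.exp (b * a) * ∫ y in U, w y ∂μ ≤ ∫ y in S, Real.exp (b * g y) * w y ∂μ := by
      rw [← integral_const_mul]
      refine (setIntegral_mono_on ((hw.mono_set hUS).const_mul _) ((hI b hb0.le).mono_set hUS)
        hU.measurableSet fun y hy => ?_).trans
        (setIntegral_mono_set (hI b hb0.le) ?_ hUS.eventuallyLE)
      · exact mul_le_mul_of_nonneg_right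
          (Real.exp_le_exp.2 (mul_le_mul_of_nonneg_left (le_of_lt hy.2) hb0.le))
          (hpos y (hUS hy)).le
      · exact ae_restrict_of_forall_mem hS.measurableSet fun y hy =>
          (mul_pos (Real.exp_pos _) (hpos y hy)).le
    have h2 := Real.log_le_log (mul_pos (Real.exp_pos _) hWU) h1
    rw [Real.log_mul (Real.exp_pos _).ne' hWU.ne', Real.log_exp] at h2
    rw [le_div_iff₀ hb0]
    calc (a + Real.log (∫ y in U, w y ∂μ) / b) * b
        = b * a + Real.log (∫ y in U, w y ∂μ) := by field_simp
      _ ≤ _ := h2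
  -- upper bound: `g ≤ sup g`
  · have hW : 0 < ∫ y in S, w y ∂μ := setIntegral_pos_of_isOpen hS hne hw hpos
    filter_upwards [(tendsto_order.1 (hvan (sSup (g '' S)) (Real.log (∫ y in S, w y ∂μ)))).2 a' ha',
      eventually_gt_atTop 0] with b hlt hb0
    refine lt_of_le_of_lt ?_ hlt
    have h1 : ∫ y in S, Real.exp (b * g y) * w y ∂μ ≤
        Real.exp (b * sSup (g '' S)) * ∫ y in S, w y ∂μ := by
      rw [← integral_const_mul]
      refine setIntegral_mono_on (hI b hb0.le) (hw.const_mul _) hS.measurableSet fun y hy => ?_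
      exact mul_le_mul_of_nonneg_right
        (Real.exp_le_exp.2 (mul_le_mul_of_nonneg_left (le_csSup hb ⟨y, hy, rfl⟩) hb0.le))
        (hpos y hy).le
    have h2 := Real.log_le_log (hIpos b hb0.le) h1
    rw [Real.log_mul (Real.exp_pos _).ne' hW.ne', Real.log_exp] at h2
    rw [div_le_iff₀ hb0]
    calc _ ≤ _ := h2
      _ = (sSup (g '' S) + Real.log (∫ y in S, w y ∂μ) / b) * b := by field_simp

end Laplace

theorem tendsto_zero_of_log_div {f : ℝ → ℝ} {a : ℝ} (ha : a < 0) (hf : ∀ᶠ b in atTop, 0 < f b)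
    (h : Tendsto (fun b => Real.log (f b) / b) atTop (𝓝 a)) : Tendsto f atTop (𝓝 0) := by
  have h1 : Tendsto (fun b => Real.exp (Real.log (f b) / b * b)) atTop (𝓝 0) :=
    Real.tendsto_exp_atBot.comp (h.neg_mul_atTop ha tendsto_id)
  refine h1.congr' ?_
  filter_upwards [hf, eventually_gt_atTop 0] with b hb hb0
  rw [div_mul_cancel₀ _ hb0.ne', Real.exp_log hb]

theorem tendsto_atTop_of_log_div {f : ℝ → ℝ} {a : ℝ} (ha : 0 < a) (hf : ∀ᶠ b in atTop, 0 < f b)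
    (h : Tendsto (fun b => Real.log (f b) / b) atTop (𝓝 a)) : Tendsto f atTop atTop := by
  have h1 : Tendsto (fun b => Real.exp (Real.log (f b) / b * b)) atTop atTop :=
    Real.tendsto_exp_atTop.comp (h.pos_mul_atTop ha tendsto_id)
  refine h1.congr' ?_
  filter_upwards [hf, eventually_gt_atTop 0] with b hb hb0
  rw [div_mul_cancel₀ _ hb0.ne', Real.exp_log hb]

/-! ### The log-partition function and the marginal likelihoods -/

section Family

variable {𝒳 : Type*} [MeasurableSpace 𝒳] {d n : ℕ} (E : ExpFamily 𝒳 d)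

theorem ExpFamily.exp_inner_convex_combination_le {θ₁ θ₂ : EuclideanSpace ℝ (Fin d)} {a b : ℝ}
    (ha : 0 ≤ a) (hb : 0 ≤ b) (hab : a + b = 1) (x : 𝒳) :
    Real.exp (inner ℝ (E.t x) (a • θ₁ + b • θ₂) - E.h x) ≤
      a * Real.exp (inner ℝ (E.t x) θ₁ - E.h x) + b * Real.exp (inner ℝ (E.t x) θ₂ - E.h x) := by
  have h := convexOn_exp.2 (Set.mem_univ (inner ℝ (E.t x) θ₁ - E.h x))
    (Set.mem_univ (inner ℝ (E.t x) θ₂ - E.h x)) ha hb hab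
  refine le_of_eq_of_le ?_ h
  congr 1
  rw [inner_add_right, inner_smul_right, inner_smul_right, smul_eq_mul, smul_eq_mul]
  linear_combination (-E.h x) * hab.symm

theorem ExpFamily.convex_Θ : Convex ℝ E.Θ := by
  intro θ₁ h₁ θ₂ h₂ a b ha hb hab
  refine Integrable.mono' ((Integrable.const_mul h₁ a).add (Integrable.const_mul h₂ b)) ?_
    (Eventually.of_forall fun x => ?_)
  · have := E.measurable_t
    have := E.measurable_h
    exact Measurable.aestronglyMeasurable (by fun_prop)
  · rw [Real.norm_eq_abs, Real.abs_exp]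
    exact E.exp_inner_convex_combination_le ha hb hab x

/-- The partition function `exp ∘ ψ` is an integral of convex functions of `θ`, so it is convex,
and a convex function on an open subset of `ℝ^d` is continuous. -/
theorem ExpFamily.continuousOn_ψ : ContinuousOn E.ψ E.Θ := by
  have hconv : ConvexOn ℝ E.Θ
      (fun θ => ∫ x, Real.exp (inner ℝ (E.t x) θ - E.h x) ∂E.ref) := by
    refine ⟨E.convex_Θ, fun θ₁ h₁ θ₂ h₂ a b ha hb hab => ?_⟩
    simp only [smul_eq_mul]
    rw [← integral_const_mul, ← integral_const_mul,
      ← integral_add (Integrable.const_mul h₁ a) (Integrable.const_mul h₂ b)]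
    exact integral_mono (E.convex_Θ h₁ h₂ ha hb hab)
      ((Integrable.const_mul h₁ a).add (Integrable.const_mul h₂ b))
      fun x => E.exp_inner_convex_combination_le ha hb hab x
  have : NeZero E.ref := ⟨E.ref_ne_zero⟩
  exact (hconv.continuousOn E.regular).log fun θ hθ => (integral_exp_pos hθ).ne'

variable (P : E.ConjPrior) (hs : ℝ → 𝒳 → ℝ) (X : Fin n → 𝒳)

theorem card_mul_inner_tbar {c : Finset (Fin n)} (hc : c.Nonempty)
    (θ : EuclideanSpace ℝ (Fin d)) :
    (c.card : ℝ) * inner ℝ (tbar E X c) θ = ∑ i ∈ c, inner ℝ (E.t (X i)) θ := by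
  have : (c.card : ℝ) ≠ 0 := by exact_mod_cast hc.card_pos.ne'
  rw [tbar, real_inner_smul_left, sum_inner, mul_inv_cancel_left₀ this]

theorem tbar_mem_domφ (hX : ∀ i, E.t (X i) ∈ E.domφ) {c : Finset (Fin n)} (hc : c.Nonempty) :
    tbar E X c ∈ E.domφ := by
  choose B hB using hX
  have hcard : (0 : ℝ) < c.card := by exact_mod_cast hc.card_pos
  refine ⟨(c.card : ℝ)⁻¹ * ∑ i ∈ c, B i, ?_⟩
  rintro _ ⟨θ, hθ, rfl⟩
  rw [le_inv_mul_iff₀ hcard, mul_sub, card_mul_inner_tbar E X hc, ← nsmul_eq_mul,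
    ← Finset.sum_const, ← Finset.sum_sub_distrib]
  exact Finset.sum_le_sum fun i _ => hB i ⟨θ, hθ, rfl⟩

/-- The integral of `exp (b (⟪μ, θ⟫ - ψ θ))` over `Θ` against the unnormalized conjugate prior. Its
rate in `b` is `φ μ`. -/
noncomputable def laplaceIntegral (μ : EuclideanSpace ℝ (Fin d)) (b : ℝ) : ℝ :=
  ∫ θ in E.Θ, Real.exp (b * (inner ℝ μ θ - E.ψ θ)) * Real.exp (inner ℝ P.τ θ - P.ν * E.ψ θ)

/-- The marginal likelihood in the unscaled parameter `θ = θ̃ / β`. -/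
theorem marginal_eq {c : Finset (Fin n)} (hc : c.Nonempty) {β : ℝ} (hβ : 0 < β) :
    marginal E P hs X β c = β ^ d * Real.exp (-(∑ i ∈ c, hs β (X i)) - P.ξ) *
      laplaceIntegral E P (tbar E X c) (c.card * β) := by
  have hcv := Measure.setIntegral_comp_smul_of_pos (volume : Measure (EuclideanSpace ℝ (Fin d)))
    (fun θ' => (∏ i ∈ c, E.scaledDensity hs β (X i) θ') * P.scaledDensity β θ') E.Θ hβ
  rw [finrank_euclideanSpace_fin, smul_eq_mul, eq_inv_mul_iff_mul_eq₀ (by positivity)] at hcv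
  rw [marginal, ← hcv, mul_assoc, laplaceIntegral]
  congr 1
  rw [← integral_const_mul]
  congr 1
  funext θ
  simp only [ExpFamily.scaledDensity, ExpFamily.ConjPrior.scaledDensity, ExpFamily.scaledψ]
  rw [← Real.exp_sum, ← Real.exp_add, ← Real.exp_add, ← Real.exp_add, inv_smul_smul₀ hβ.ne',
    Finset.sum_sub_distrib, Finset.sum_sub_distrib, Finset.sum_const, nsmul_eq_mul]
  simp only [inner_smul_right, real_inner_smul_left]
  rw [← Finset.mul_sum, ← card_mul_inner_tbar E X hc, real_inner_comm θ P.τ]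
  congr 1
  field_simp
  ring

theorem laplaceIntegral_pos {μ : EuclideanSpace ℝ (Fin d)} (hμ : μ ∈ E.domφ) {b : ℝ}
    (hb : 0 ≤ b) : 0 < laplaceIntegral E P μ b :=
  setIntegral_pos_of_isOpen E.regular E.nonempty
    (integrableOn_exp_mul E.regular (ContinuousOn.sub (by fun_prop) E.continuousOn_ψ) hμ P.proper
      hb)
    fun θ _ => mul_pos (Real.exp_pos _) (Real.exp_pos _)

theorem tendsto_log_laplaceIntegral {μ : EuclideanSpace ℝ (Fin d)} (hμ : μ ∈ E.domφ) {m : ℝ}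
    (hm : 0 < m) :
    Tendsto (fun β : ℝ => Real.log (laplaceIntegral E P μ (m * β)) / β) atTop
      (𝓝 (m * E.φ μ)) := by
  have h : Tendsto (fun b => Real.log (laplaceIntegral E P μ b) / b) atTop (𝓝 (E.φ μ)) :=
    tendsto_log_setIntegral_exp_div E.regular E.nonempty
      (ContinuousOn.sub (by fun_prop) E.continuousOn_ψ) hμ P.proper fun θ _ => Real.exp_pos _
  refine ((h.comp (tendsto_id.const_mul_atTop hm)).const_mul m).congr fun β => ?_
  simp only [Function.comp_apply, id]
  field_simp

variable {E} in
theorem marginal_pos (hX : ∀ i, E.t (X i) ∈ E.domφ) {c : Finset (Fin n)} (hc : c.Nonempty)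
    {β : ℝ} (hβ : 0 < β) : 0 < marginal E P hs X β c := by
  rw [marginal_eq E P hs X hc hβ]
  have := laplaceIntegral_pos E P (tbar_mem_domφ E X hX hc)
    (mul_nonneg (Nat.cast_nonneg c.card) hβ.le)
  positivity

theorem conc_pos (d : ℕ) (lam : ℝ) {β : ℝ} (hβ : 0 < β) : 0 < conc d lam β := by
  unfold conc; positivity

theorem gamma_card_pos {c : Finset (Fin n)} (hc : c.Nonempty) : 0 < Real.Gamma c.card :=
  Real.Gamma_pos_of_pos (by exact_mod_cast hc.card_pos)

variable {E}

theorem potH_pos (hX : ∀ i, E.t (X i) ∈ E.domφ) (lam : ℝ) {c : Finset (Fin n)}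
    (hc : c.Nonempty) {β : ℝ} (hβ : 0 < β) : 0 < potH E P hs X (conc d lam β) β c :=
  mul_pos (mul_pos (conc_pos d lam hβ) (gamma_card_pos hc)) (marginal_pos P hs X hX hc hβ)

/-- The exponential rate of the potential `φ(X_c | H_c)`. The arbitrary terms `h_β(x_i)` need
not have a rate and are added back; they cancel in the dissimilarities. -/
theorem tendsto_log_potH (hX : ∀ i, E.t (X i) ∈ E.domφ) (lam : ℝ) {c : Finset (Fin n)}
    (hc : c.Nonempty) :
    Tendsto (fun β => (Real.log (potH E P hs X (conc d lam β) β c) + ∑ i ∈ c, hs β (X i)) / β)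
      atTop (𝓝 (c.card * E.φ (tbar E X c) - lam)) := by
  have hμ := tbar_mem_domφ E X hX hc
  have hlim := tendsto_log_laplaceIntegral E P hμ (m := c.card) (by exact_mod_cast hc.card_pos)
  have hlog : Tendsto (fun β : ℝ => Real.log β / β) atTop (𝓝 0) :=
    Real.isLittleO_log_id_atTop.tendsto_div_nhds_zero
  have hconst : Tendsto (fun β : ℝ => (Real.log (Real.Gamma c.card) - P.ξ) / β) atTop (𝓝 0) :=
    tendsto_id.const_div_atTop _
  have hsum := ((hlim.add (hlog.const_mul ((d : ℝ) / 2))).add hconst).sub_const lam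
  simp only [mul_zero, add_zero] at hsum
  refine hsum.congr' ?_
  filter_upwards [eventually_gt_atTop 0] with β hβ
  have hI := laplaceIntegral_pos E P hμ (mul_nonneg (Nat.cast_nonneg c.card) hβ.le)
  have hG := gamma_card_pos hc
  have hr : 0 < β ^ (-((d : ℝ) / 2)) := by positivity
  rw [potH, marginal_eq E P hs X hc hβ, conc, Real.log_mul (by positivity) (by positivity),
    Real.log_mul (by positivity) hG.ne', Real.log_mul hr.ne' (by positivity),
    Real.log_mul (by positivity) hI.ne', Real.log_mul (by positivity) (by positivity),
    Real.log_rpow hβ, Real.log_pow, Real.log_exp, Real.log_exp]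
  field_simp
  ring

/-! ### Tree potentials and the rate of the dissimilarity -/

theorem ClusterTree.cluster_nonempty (T : ClusterTree n) : T.cluster.Nonempty := by
  induction T with
  | leaf i => exact Finset.singleton_nonempty i
  | node l r hl _ => exact hl.mono Finset.subset_union_left

theorem ClusterTree.gam_pos {α : ℝ} (hα : 0 < α) (T : ClusterTree n) : 0 < T.gam α := by
  induction T with
  | leaf i => exact hα
  | node l r hl hr =>
    exact add_pos (mul_pos hα (gamma_card_pos (node l r).cluster_nonempty)) (mul_pos hl hr)

variable (E) in
theorem potT_leaf (α β : ℝ) (i : Fin n) :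
    potT E P hs X α β (.leaf i) = potH E P hs X α β (ClusterTree.leaf i).cluster := by
  simp [potT, potH, treeLik, ClusterTree.gam, ClusterTree.cluster]

variable (E) in
/-- In terms of potentials, the recursion for the tree likelihood is
`φ(X_c | T_c) = φ(X_c | H_c) + φ(X_{c₀} | T_{c₀}) φ(X_{c₁} | T_{c₁})`. -/
theorem potT_node {α : ℝ} (hα : 0 < α) (β : ℝ) (l r : ClusterTree n) :
    potT E P hs X α β (.node l r) = potH E P hs X α β (ClusterTree.node l r).cluster +
      potT E P hs X α β l * potT E P hs X α β r := by
  have hγ := (ClusterTree.node l r).gam_pos hα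
  have hg : (ClusterTree.node l r).gam α =
      α * Real.Gamma (ClusterTree.node l r).cluster.card + l.gam α * r.gam α := rfl
  have hp : (ClusterTree.node l r).gam α * (ClusterTree.node l r).priorProb α =
      α * Real.Gamma (ClusterTree.node l r).cluster.card := mul_div_cancel₀ _ hγ.ne'
  have hcl : (ClusterTree.node l r).cluster = l.cluster ∪ r.cluster := rfl
  simp only [potT, potH, treeLik, ← hcl]
  linear_combination (marginal E P hs X β (ClusterTree.node l r).cluster -
    treeLik E P hs X α β l * treeLik E P hs X α β r) * hp +
    treeLik E P hs X α β l * treeLik E P hs X α β r * hg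

theorem potH_le_potT (hX : ∀ i, E.t (X i) ∈ E.domφ) (lam : ℝ) {β : ℝ} (hβ : 0 < β)
    (T : ClusterTree n) :
    potH E P hs X (conc d lam β) β T.cluster ≤ potT E P hs X (conc d lam β) β T := by
  induction T with
  | leaf i => exact (potT_leaf E P hs X _ β i).ge
  | node l r hl hr =>
    rw [potT_node E P hs X (conc_pos d lam hβ)]
    exact le_add_of_nonneg_right (mul_nonneg
      ((potH_pos P hs X hX lam l.cluster_nonempty hβ).le.trans hl)
      ((potH_pos P hs X hX lam r.cluster_nonempty hβ).le.trans hr))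

theorem potT_pos (hX : ∀ i, E.t (X i) ∈ E.domφ) (lam : ℝ) {β : ℝ} (hβ : 0 < β)
    (T : ClusterTree n) : 0 < potT E P hs X (conc d lam β) β T :=
  (potH_pos P hs X hX lam T.cluster_nonempty hβ).trans_le (potH_le_potT P hs X hX lam hβ T)

theorem union_cluster_nonempty (T₀ T₁ : ClusterTree n) : (T₀.cluster ∪ T₁.cluster).Nonempty :=
  (ClusterTree.node T₀ T₁).cluster_nonempty

theorem dissim_pos (hX : ∀ i, E.t (X i) ∈ E.domφ) (lam : ℝ) {β : ℝ} (hβ : 0 < β)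
    (T₀ T₁ : ClusterTree n) : 0 < dissim E P hs X lam β T₀ T₁ :=
  div_pos (mul_pos (potT_pos P hs X hX lam hβ T₀) (potT_pos P hs X hX lam hβ T₁))
    (potH_pos P hs X hX lam (union_cluster_nonempty T₀ T₁) hβ)

theorem potT_eq_mul_one_add_childDissim (hX : ∀ i, E.t (X i) ∈ E.domφ) (lam : ℝ) {β : ℝ}
    (hβ : 0 < β) (T : ClusterTree n) :
    potT E P hs X (conc d lam β) β T =
      potH E P hs X (conc d lam β) β T.cluster * (1 + childDissim E P hs X lam β T) := by
  cases T with
  | leaf i => rw [potT_leaf, childDissim, add_zero, mul_one]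
  | node l r =>
    have hH : potH E P hs X (conc d lam β) β (l.cluster ∪ r.cluster) ≠ 0 :=
      (potH_pos P hs X hX lam (union_cluster_nonempty l r) hβ).ne'
    rw [potT_node E P hs X (conc_pos d lam hβ), childDissim, dissim, dissimOf, mul_add, mul_one,
      ClusterTree.cluster, mul_div_cancel₀ _ hH]

/-- Under the vanishing of the dissimilarity of the root subtrees, the tree potential has the same
rate as the potential of a single cluster. -/
theorem tendsto_log_potT (hX : ∀ i, E.t (X i) ∈ E.domφ) (lam : ℝ) {T : ClusterTree n}
    (hT : Tendsto (fun β => childDissim E P hs X lam β T) atTop (𝓝 0)) :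
    Tendsto
      (fun β => (Real.log (potT E P hs X (conc d lam β) β T) + ∑ i ∈ T.cluster, hs β (X i)) / β)
      atTop (𝓝 (T.cluster.card * E.φ (tbar E X T.cluster) - lam)) := by
  have h1 : Tendsto (fun β => Real.log (1 + childDissim E P hs X lam β T)) atTop (𝓝 0) := by
    have := (hT.const_add 1).log (by norm_num)
    simpa using this
  have h2 := (tendsto_log_potH P hs X hX lam T.cluster_nonempty).add (h1.div_atTop tendsto_id)
  rw [add_zero] at h2
  refine h2.congr' ?_
  filter_upwards [eventually_gt_atTop 0] with β hβ
  have hH := potH_pos P hs X hX lam T.cluster_nonempty hβ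
  have hT' := potT_pos P hs X hX lam hβ T
  rw [potT_eq_mul_one_add_childDissim P hs X hX lam hβ] at hT' ⊢
  rw [Real.log_mul hH.ne' (pos_of_mul_pos_right hT' hH.le).ne', id, ← add_div]
  ring

/-- Combination of the rates of three potentials into the rate of a dissimilarity. The terms
`h_β(x_i)` cancel because the clusters are disjoint. -/
theorem tendsto_log_mul_div_potH (hX : ∀ i, E.t (X i) ∈ E.domφ) (lam : ℝ)
    {c₀ c₁ : Finset (Fin n)} (h₀ : c₀.Nonempty) (hdisj : Disjoint c₀ c₁) {f₀ f₁ : ℝ → ℝ}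
    (hf₀ : ∀ β, 0 < β → 0 < f₀ β) (hf₁ : ∀ β, 0 < β → 0 < f₁ β)
    (hl₀ : Tendsto (fun β => (Real.log (f₀ β) + ∑ i ∈ c₀, hs β (X i)) / β) atTop
      (𝓝 (c₀.card * E.φ (tbar E X c₀) - lam)))
    (hl₁ : Tendsto (fun β => (Real.log (f₁ β) + ∑ i ∈ c₁, hs β (X i)) / β) atTop
      (𝓝 (c₁.card * E.φ (tbar E X c₁) - lam))) :
    Tendsto (fun β => Real.log (f₀ β * f₁ β / potH E P hs X (conc d lam β) β (c₀ ∪ c₁)) / β)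
      atTop (𝓝 (dStar E X c₀ c₁ - lam)) := by
  have hc : (c₀ ∪ c₁).Nonempty := h₀.mono Finset.subset_union_left
  have h := (hl₀.add hl₁).sub (tendsto_log_potH P hs X hX lam hc)
  have e : c₀.card * E.φ (tbar E X c₀) - lam + (c₁.card * E.φ (tbar E X c₁) - lam) -
      ((c₀ ∪ c₁).card * E.φ (tbar E X (c₀ ∪ c₁)) - lam) = dStar E X c₀ c₁ - lam := by
    rw [dStar]; ring
  rw [e] at h
  refine h.congr' ?_
  filter_upwards [eventually_gt_atTop 0] with β hβ
  have hH := potH_pos P hs X hX lam hc hβ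
  rw [Real.log_div (mul_pos (hf₀ β hβ) (hf₁ β hβ)).ne' hH.ne',
    Real.log_mul (hf₀ β hβ).ne' (hf₁ β hβ).ne', Finset.sum_union hdisj]
  ring

theorem tendsto_log_dissim (hX : ∀ i, E.t (X i) ∈ E.domφ) (lam : ℝ) {T₀ T₁ : ClusterTree n}
    (hdisj : Disjoint T₀.cluster T₁.cluster)
    (h₀ : Tendsto (fun β => childDissim E P hs X lam β T₀) atTop (𝓝 0))
    (h₁ : Tendsto (fun β => childDissim E P hs X lam β T₁) atTop (𝓝 0)) :
    Tendsto (fun β => Real.log (dissim E P hs X lam β T₀ T₁) / β) atTop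
      (𝓝 (dStar E X T₀.cluster T₁.cluster - lam)) :=
  tendsto_log_mul_div_potH P hs X hX lam T₀.cluster_nonempty hdisj
    (fun _ hβ => potT_pos P hs X hX lam hβ T₀) (fun _ hβ => potT_pos P hs X hX lam hβ T₁)
    (tendsto_log_potT P hs X hX lam h₀) (tendsto_log_potT P hs X hX lam h₁)

theorem eventually_dissim_pos (hX : ∀ i, E.t (X i) ∈ E.domφ) (lam : ℝ) (T₀ T₁ : ClusterTree n) :
    ∀ᶠ β in atTop, 0 < dissim E P hs X lam β T₀ T₁ := by
  filter_upwards [eventually_gt_atTop 0] with β hβ using dissim_pos P hs X hX lam hβ T₀ T₁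

theorem tendsto_dissim_zero (hX : ∀ i, E.t (X i) ∈ E.domφ) (lam : ℝ) {T₀ T₁ : ClusterTree n}
    (hdisj : Disjoint T₀.cluster T₁.cluster)
    (h₀ : Tendsto (fun β => childDissim E P hs X lam β T₀) atTop (𝓝 0))
    (h₁ : Tendsto (fun β => childDissim E P hs X lam β T₁) atTop (𝓝 0))
    (h : dStar E X T₀.cluster T₁.cluster < lam) :
    Tendsto (fun β => dissim E P hs X lam β T₀ T₁) atTop (𝓝 0) :=
  tendsto_zero_of_log_div (sub_neg.2 h) (eventually_dissim_pos P hs X hX lam T₀ T₁)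
    (tendsto_log_dissim P hs X hX lam hdisj h₀ h₁)

/-- No condition on the subtrees is needed here: replacing tree potentials by the smaller potentials
`φ(X_c | H_c)` gives a lower bound that already tends to infinity. -/
theorem tendsto_dissim_atTop (hX : ∀ i, E.t (X i) ∈ E.domφ) (lam : ℝ) {T₀ T₁ : ClusterTree n}
    (hdisj : Disjoint T₀.cluster T₁.cluster) (h : lam < dStar E X T₀.cluster T₁.cluster) :
    Tendsto (fun β => dissim E P hs X lam β T₀ T₁) atTop atTop := by
  have hlim := tendsto_log_mul_div_potH P hs X hX lam T₀.cluster_nonempty hdisj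
    (fun _ hβ => potH_pos P hs X hX lam T₀.cluster_nonempty hβ)
    (fun _ hβ => potH_pos P hs X hX lam T₁.cluster_nonempty hβ)
    (tendsto_log_potH P hs X hX lam T₀.cluster_nonempty)
    (tendsto_log_potH P hs X hX lam T₁.cluster_nonempty)
  refine tendsto_atTop_mono' _ ?_ (tendsto_atTop_of_log_div (sub_pos.2 h) ?_ hlim)
  · filter_upwards [eventually_gt_atTop 0] with β hβ
    have hH := potH_pos P hs X hX lam (union_cluster_nonempty T₀ T₁) hβ
    exact div_le_div_of_nonneg_right
      (mul_le_mul (potH_le_potT P hs X hX lam hβ T₀) (potH_le_potT P hs X hX lam hβ T₁)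
        (potH_pos P hs X hX lam T₁.cluster_nonempty hβ).le (potT_pos P hs X hX lam hβ T₀).le)
      hH.le
  · filter_upwards [eventually_gt_atTop 0] with β hβ
    exact div_pos (mul_pos (potH_pos P hs X hX lam T₀.cluster_nonempty hβ)
      (potH_pos P hs X hX lam T₁.cluster_nonempty hβ))
      (potH_pos P hs X hX lam (union_cluster_nonempty T₀ T₁) hβ)

theorem tendsto_childDissim_of_allMerges (hX : ∀ i, E.t (X i) ∈ E.domφ) (lam : ℝ)
    (T : ClusterTree n) (hV : T.Valid)
    (hT : T.AllMerges fun c₀ c₁ => dStar E X c₀ c₁ < lam) :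
    Tendsto (fun β => childDissim E P hs X lam β T) atTop (𝓝 0) := by
  induction T with
  | leaf i => exact tendsto_const_nhds
  | node l r hl hr =>
    exact tendsto_dissim_zero P hs X hX lam hV.2.2 (hl hV.1 hT.1) (hr hV.2.1 hT.2.1) hT.2.2

theorem tendsto_log_dissim_div_dissim (hX : ∀ i, E.t (X i) ∈ E.domφ) (lam : ℝ)
    {T₀ T₁ T₂ T₃ : ClusterTree n}
    (h01 : Disjoint T₀.cluster T₁.cluster) (h23 : Disjoint T₂.cluster T₃.cluster)
    (hC : ∀ T ∈ [T₀, T₁, T₂, T₃],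
      Tendsto (fun β => childDissim E P hs X lam β T) atTop (𝓝 0)) :
    Tendsto
      (fun β => Real.log (dissim E P hs X lam β T₀ T₁ / dissim E P hs X lam β T₂ T₃) / β)
      atTop (𝓝 (dStar E X T₀.cluster T₁.cluster - dStar E X T₂.cluster T₃.cluster)) := by
  have h := (tendsto_log_dissim P hs X hX lam h01 (hC T₀ (by simp)) (hC T₁ (by simp))).sub
    (tendsto_log_dissim P hs X hX lam h23 (hC T₂ (by simp)) (hC T₃ (by simp)))
  rw [sub_sub_sub_cancel_right] at h
  refine h.congr' ?_
  filter_upwards [eventually_gt_atTop 0] with β hβ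
  rw [Real.log_div (dissim_pos P hs X hX lam hβ _ _).ne' (dissim_pos P hs X hX lam hβ _ _).ne',
    sub_div]

theorem eventually_dissim_div_dissim_pos (hX : ∀ i, E.t (X i) ∈ E.domφ) (lam : ℝ)
    (T₀ T₁ T₂ T₃ : ClusterTree n) :
    ∀ᶠ β in atTop, 0 < dissim E P hs X lam β T₀ T₁ / dissim E P hs X lam β T₂ T₃ := by
  filter_upwards [eventually_gt_atTop 0] with β hβ using
    div_pos (dissim_pos P hs X hX lam hβ _ _) (dissim_pos P hs X hX lam hβ _ _)

variable (E) in
theorem dissim_comm (lam β : ℝ) (T₀ T₁ : ClusterTree n) :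
    dissim E P hs X lam β T₀ T₁ = dissim E P hs X lam β T₁ T₀ := by
  rw [dissim, dissim, dissimOf, dissimOf, mul_comm, Finset.union_comm]

end Family

/-! ### Greedy agglomeration -/

section Greedy

variable {n : ℕ}

/-- A valid tree has at most `n` leaves, hence bounded height. -/
theorem finite_setOf_valid (n : ℕ) : {T : ClusterTree n | T.Valid}.Finite := by
  suffices h : ∀ k : ℕ, {T : ClusterTree n | T.Valid ∧ T.cluster.card ≤ k}.Finite by
    refine (h n).subset fun T hT => ⟨hT, ?_⟩
    simpa using Finset.card_le_univ T.cluster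
  intro k
  induction k with
  | zero =>
    refine Set.finite_empty.subset fun T hT => ?_
    exact absurd hT.2 (by simpa using T.cluster_nonempty.ne_empty)
  | succ k ih =>
    refine ((Set.finite_range ClusterTree.leaf).union
      (ih.image2 ClusterTree.node ih)).subset ?_
    rintro (i | ⟨l, r⟩) ⟨hV, hc⟩
    · exact Or.inl ⟨i, rfl⟩
    · obtain ⟨hl, hr, hd⟩ := hV
      have h1 := l.cluster_nonempty.card_pos
      have h2 := r.cluster_nonempty.card_pos
      rw [ClusterTree.cluster, Finset.card_union_of_disjoint hd] at hc
      exact Or.inr ⟨l, ⟨hl, by omega⟩, r, ⟨hr, by omega⟩, rfl⟩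

/-- The invariant of greedy runs: the current trees are valid, all their merges satisfy `p`, and
the clusters of distinct trees are disjoint. -/
def IsForest (p : Finset (Fin n) → Finset (Fin n) → Prop) (F : Set (ClusterTree n)) : Prop :=
  (∀ T ∈ F, T.Valid ∧ T.AllMerges p) ∧ F.Pairwise fun T S => Disjoint T.cluster S.cluster

theorem IsForest.finite {p : Finset (Fin n) → Finset (Fin n) → Prop} {F : Set (ClusterTree n)}
    (hF : IsForest p F) : F.Finite :=
  (finite_setOf_valid n).subset fun T hT => (hF.1 T hT).1

theorem isForest_range_leaf (p : Finset (Fin n) → Finset (Fin n) → Prop) :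
    IsForest p (Set.range ClusterTree.leaf) := by
  refine ⟨?_, ?_⟩
  · rintro _ ⟨i, rfl⟩
    exact ⟨trivial, trivial⟩
  · rintro _ ⟨i, rfl⟩ _ ⟨j, rfl⟩ hij
    exact Finset.disjoint_singleton.2 fun h => hij (h ▸ rfl)

theorem IsForest.merge {p : Finset (Fin n) → Finset (Fin n) → Prop} {F : Set (ClusterTree n)}
    (hF : IsForest p F) {T₀ T₁ : ClusterTree n} (h₀ : T₀ ∈ F) (h₁ : T₁ ∈ F) (hne : T₀ ≠ T₁)
    (hp : p T₀.cluster T₁.cluster) :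
    IsForest p (insert (ClusterTree.node T₀ T₁) (F \ {T₀, T₁})) := by
  refine ⟨?_, ?_⟩
  · rintro T (rfl | hT)
    · exact ⟨⟨(hF.1 _ h₀).1, (hF.1 _ h₁).1, hF.2 h₀ h₁ hne⟩, (hF.1 _ h₀).2, (hF.1 _ h₁).2, hp⟩
    · exact hF.1 T hT.1
  · refine Set.Pairwise.insert (hF.2.mono Set.sdiff_subset) fun S hS _ => ?_
    have hd : Disjoint (ClusterTree.node T₀ T₁).cluster S.cluster :=
      Finset.disjoint_union_left.2
        ⟨hF.2 h₀ hS.1 fun h => hS.2 (Or.inl h.symm), hF.2 h₁ hS.1 fun h => hS.2 (Or.inr h.symm)⟩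
    exact ⟨hd, hd.symm⟩

theorem GreedyReach.isForest {D : ClusterTree n → ClusterTree n → ℝ} {thr : ℝ}
    {p : Finset (Fin n) → Finset (Fin n) → Prop}
    (hp : ∀ F T₀ T₁, GreedyReach D thr F → IsClosestPair D F T₀ T₁ → D T₀ T₁ ≤ thr →
      p T₀.cluster T₁.cluster)
    {F : Set (ClusterTree n)} (hF : GreedyReach D thr F) : IsForest p F := by
  induction hF with
  | refl => exact isForest_range_leaf p
  | tail hr hstep ih =>
    obtain ⟨T₀, T₁, hc, hle, rfl⟩ := hstep
    exact ih.merge hc.1 hc.2.1 hc.2.2.1 (hp _ _ _ hr hc hle)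

theorem exists_isClosestPair (D : ClusterTree n → ClusterTree n → ℝ) {F : Set (ClusterTree n)}
    (hF : F.Finite) {T₀ T₁ : ClusterTree n} (h₀ : T₀ ∈ F) (h₁ : T₁ ∈ F) (hne : T₀ ≠ T₁) :
    ∃ S₀ S₁, IsClosestPair D F S₀ S₁ := by
  obtain ⟨⟨S₀, S₁⟩, ⟨⟨hS₀, hS₁⟩, hS⟩, hmin⟩ := Set.exists_min_image
    {q : ClusterTree n × ClusterTree n | (q.1 ∈ F ∧ q.2 ∈ F) ∧ q.1 ≠ q.2} (fun q => D q.1 q.2)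
    ((hF.prod hF).subset fun q hq => hq.1) ⟨(T₀, T₁), ⟨h₀, h₁⟩, hne⟩
  exact ⟨S₀, S₁, hS₀, hS₁, hS, fun A hA B hB hAB => hmin (A, B) ⟨⟨hA, hB⟩, hAB⟩⟩

/-- `D'` refines `D` on `F`, with the threshold `thr'` in the place of `thr`: strict inequalities
for `D` between pairs of distinct trees, and between such a pair and the threshold, hold for `D'`
as well. -/
structure Refines (D D' : ClusterTree n → ClusterTree n → ℝ) (thr thr' : ℝ)
    (F : Set (ClusterTree n)) : Prop where
  lt_of_lt : ∀ T₀ ∈ F, ∀ T₁ ∈ F, T₀ ≠ T₁ → ∀ S₀ ∈ F, ∀ S₁ ∈ F, S₀ ≠ S₁ →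
    D T₀ T₁ < D S₀ S₁ → D' T₀ T₁ < D' S₀ S₁
  lt_thr : ∀ T₀ ∈ F, ∀ T₁ ∈ F, T₀ ≠ T₁ → D T₀ T₁ < thr → D' T₀ T₁ < thr'
  thr_lt : ∀ T₀ ∈ F, ∀ T₁ ∈ F, T₀ ≠ T₁ → thr < D T₀ T₁ → thr' < D' T₀ T₁

variable {D D' : ClusterTree n → ClusterTree n → ℝ} {thr thr' : ℝ} {F F' : Set (ClusterTree n)}

theorem Refines.isClosestPair (h : Refines D D' thr thr' F) {T₀ T₁ : ClusterTree n}
    (hc : IsClosestPair D' F T₀ T₁) : IsClosestPair D F T₀ T₁ := by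
  obtain ⟨h₀, h₁, hne, hmin⟩ := hc
  refine ⟨h₀, h₁, hne, fun S₀ hS₀ S₁ hS₁ hS => le_of_not_gt fun hlt => ?_⟩
  exact (h.lt_of_lt S₀ hS₀ S₁ hS₁ hS T₀ h₀ T₁ h₁ hne hlt).not_ge (hmin S₀ hS₀ S₁ hS₁ hS)

theorem Refines.greedyStep (h : Refines D D' thr thr' F) (hs : GreedyStep D' thr' F F') :
    GreedyStep D thr F F' := by
  obtain ⟨T₀, T₁, hc, hle, rfl⟩ := hs
  exact ⟨T₀, T₁, h.isClosestPair hc,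
    le_of_not_gt fun hlt => (h.thr_lt T₀ hc.1 T₁ hc.2.1 hc.2.2.1 hlt).not_ge hle, rfl⟩

/-- If `D` can make a step, then so can `D'`, since a `D'`-minimal pair is also `D`-minimal. -/
theorem Refines.exists_isClosestPair_le (h : Refines D D' thr thr' F) (hF : F.Finite)
    (htie : ∀ T₀ T₁, IsClosestPair D F T₀ T₁ → D T₀ T₁ ≠ thr) {T₀ T₁ : ClusterTree n}
    (hc : IsClosestPair D F T₀ T₁) (hle : D T₀ T₁ ≤ thr) :
    ∃ S₀ S₁, IsClosestPair D' F S₀ S₁ ∧ D' S₀ S₁ ≤ thr' := by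
  obtain ⟨S₀, S₁, hS⟩ := exists_isClosestPair D' hF hc.1 hc.2.1 hc.2.2.1
  have hS' := h.isClosestPair hS
  have hlt : D S₀ S₁ < thr :=
    lt_of_le_of_ne ((hS'.2.2.2 T₀ hc.1 T₁ hc.2.1 hc.2.2.1).trans hle) (htie S₀ S₁ hS')
  exact ⟨S₀, S₁, hS, (h.lt_thr S₀ hS.1 S₁ hS.2.1 hS.2.2.1 hlt).le⟩

theorem greedyReach_of_refines (h : ∀ F, GreedyReach D thr F → Refines D D' thr thr' F)
    (hF : GreedyReach D' thr' F) : GreedyReach D thr F := by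
  induction hF with
  | refl => exact .refl
  | tail _ hstep ih => exact ih.tail ((h _ ih).greedyStep hstep)

theorem greedyOutput_of_refines (h : ∀ F, GreedyReach D thr F → Refines D D' thr thr' F)
    (hfin : ∀ F, GreedyReach D thr F → F.Finite)
    (htie : ∀ F T₀ T₁, GreedyReach D thr F → IsClosestPair D F T₀ T₁ → D T₀ T₁ ≠ thr)
    (hF : GreedyOutput D' thr' F) : GreedyOutput D thr F := by
  have hr := greedyReach_of_refines h hF.1
  refine ⟨hr, ?_⟩
  rintro _ ⟨T₀, T₁, hc, hle, rfl⟩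
  obtain ⟨S₀, S₁, hS, hSle⟩ :=
    (h F hr).exists_isClosestPair_le (hfin F hr) (fun A B => htie F A B hr) hc hle
  exact hF.2 _ ⟨S₀, S₁, hS, hSle, rfl⟩

/-- The unique `D`-closest pair is the `D'`-closest one up to order. Since merging is ordered, the
symmetry of `D'` is used to make the same step. -/
theorem greedyReach_of_refines_of_unique
    (h : ∀ F, GreedyReach D thr F → Refines D D' thr thr' F)
    (hfin : ∀ F, GreedyReach D thr F → F.Finite)
    (htie : ∀ F T₀ T₁, GreedyReach D thr F → IsClosestPair D F T₀ T₁ → D T₀ T₁ ≠ thr)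
    (huniq : ∀ F T₀ T₁ S₀ S₁, GreedyReach D thr F → IsClosestPair D F T₀ T₁ →
      IsClosestPair D F S₀ S₁ → D T₀ T₁ ≤ thr → (S₀ = T₀ ∧ S₁ = T₁) ∨ (S₀ = T₁ ∧ S₁ = T₀))
    (hcomm : ∀ T₀ T₁, D' T₀ T₁ = D' T₁ T₀) (hF : GreedyReach D thr F) :
    GreedyReach D' thr' F := by
  induction hF with
  | refl => exact .refl
  | @tail G _ hr hstep ih =>
    obtain ⟨T₀, T₁, hc, hle, rfl⟩ := hstep
    obtain ⟨S₀, S₁, hS, hSle⟩ :=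
      (h G hr).exists_isClosestPair_le (hfin G hr) (fun A B => htie G A B hr) hc hle
    refine ih.tail ⟨T₀, T₁, ?_⟩
    rcases huniq G T₀ T₁ S₀ S₁ hr hc ((h G hr).isClosestPair hS) hle with ⟨rfl, rfl⟩ | ⟨rfl, rfl⟩
    · exact ⟨hS, hSle, rfl⟩
    · rw [hcomm S₁ S₀]
      exact ⟨⟨hS.2.1, hS.1, hS.2.2.1.symm, fun A hA B hB hAB =>
        (hcomm S₁ S₀).trans_le (hS.2.2.2 A hA B hB hAB)⟩, hSle, rfl⟩

end Greedy

section Comparison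

variable {𝒳 : Type*} [MeasurableSpace 𝒳] {d n : ℕ} {E : ExpFamily 𝒳 d} (P : E.ConjPrior)
  (hs : ℝ → 𝒳 → ℝ) (X : Fin n → 𝒳)

/-- There are finitely many valid trees, so one `β` beyond which the comparisons hold serves all
forests at once. -/
theorem eventually_refines (hX : ∀ i, E.t (X i) ∈ E.domφ) (lam : ℝ) :
    ∀ᶠ β : ℝ in atTop, ∀ F : Set (ClusterTree n),
      IsForest (fun c₀ c₁ => dStar E X c₀ c₁ < lam) F →
      Refines (dStarTree E X) (dissim E P hs X lam β) lam 1 F := by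
  set V := {T : ClusterTree n | T.Valid ∧ T.AllMerges fun c₀ c₁ => dStar E X c₀ c₁ < lam}
  have hV : V.Finite := (finite_setOf_valid n).subset fun T hT => hT.1
  have hC : ∀ T ∈ V, Tendsto (fun β => childDissim E P hs X lam β T) atTop (𝓝 0) :=
    fun T hT => tendsto_childDissim_of_allMerges P hs X hX lam T hT.1 hT.2
  have h1 : ∀ᶠ β : ℝ in atTop, ∀ T₀ ∈ V, ∀ T₁ ∈ V, ∀ S₀ ∈ V, ∀ S₁ ∈ V,
      Disjoint T₀.cluster T₁.cluster → Disjoint S₀.cluster S₁.cluster →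
      dStarTree E X T₀ T₁ < dStarTree E X S₀ S₁ →
      dissim E P hs X lam β T₀ T₁ < dissim E P hs X lam β S₀ S₁ := by
    simp only [eventually_all_finite hV, eventually_imp_distrib_left]
    intro T₀ hT₀ T₁ hT₁ S₀ hS₀ S₁ hS₁ hT hS hlt
    have hlim := tendsto_zero_of_log_div (sub_neg.2 hlt)
      (eventually_dissim_div_dissim_pos P hs X hX lam T₀ T₁ S₀ S₁)
      (tendsto_log_dissim_div_dissim P hs X hX lam hT hS (by
        simpa using ⟨hC T₀ hT₀, hC T₁ hT₁, hC S₀ hS₀, hC S₁ hS₁⟩))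
    filter_upwards [hlim.eventually_lt_const one_pos, eventually_dissim_pos P hs X hX lam S₀ S₁]
      with β hβ hpos using (div_lt_one hpos).1 hβ
  have h2 : ∀ᶠ β : ℝ in atTop, ∀ T₀ ∈ V, ∀ T₁ ∈ V, Disjoint T₀.cluster T₁.cluster →
      dStarTree E X T₀ T₁ < lam → dissim E P hs X lam β T₀ T₁ < 1 := by
    simp only [eventually_all_finite hV, eventually_imp_distrib_left]
    intro T₀ hT₀ T₁ hT₁ hT hlt
    exact (tendsto_dissim_zero P hs X hX lam hT (hC T₀ hT₀) (hC T₁ hT₁) hlt).eventually_lt_const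
      one_pos
  have h3 : ∀ᶠ β : ℝ in atTop, ∀ T₀ ∈ V, ∀ T₁ ∈ V, Disjoint T₀.cluster T₁.cluster →
      lam < dStarTree E X T₀ T₁ → 1 < dissim E P hs X lam β T₀ T₁ := by
    simp only [eventually_all_finite hV, eventually_imp_distrib_left]
    intro T₀ hT₀ T₁ hT₁ hT hlt
    exact (tendsto_dissim_atTop P hs X hX lam hT hlt).eventually_gt_atTop 1
  filter_upwards [h1, h2, h3] with β h1 h2 h3 F hF
  exact
    { lt_of_lt := fun T₀ hT₀ T₁ hT₁ hT S₀ hS₀ S₁ hS₁ hS =>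
        h1 T₀ (hF.1 _ hT₀) T₁ (hF.1 _ hT₁) S₀ (hF.1 _ hS₀) S₁ (hF.1 _ hS₁) (hF.2 hT₀ hT₁ hT)
          (hF.2 hS₀ hS₁ hS)
      lt_thr := fun T₀ hT₀ T₁ hT₁ hT => h2 T₀ (hF.1 _ hT₀) T₁ (hF.1 _ hT₁) (hF.2 hT₀ hT₁ hT)
      thr_lt := fun T₀ hT₀ T₁ hT₁ hT => h3 T₀ (hF.1 _ hT₀) T₁ (hF.1 _ hT₁) (hF.2 hT₀ hT₁ hT) }

end Comparison

end BHC

theorem mainTheorem1 {𝒳 : Type*} [MeasurableSpace 𝒳] {d n : ℕ}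
    (E : BHC.ExpFamily 𝒳 d) (P : E.ConjPrior) (hs : ℝ → 𝒳 → ℝ)
    (X : Fin n → 𝒳) (hX : ∀ i, E.t (X i) ∈ E.domφ) (lam : ℝ) :
    -- the threshold dichotomy
    (∀ T₀ T₁ : BHC.ClusterTree n, T₀.Valid → T₁.Valid → Disjoint T₀.cluster T₁.cluster →
      (Filter.Tendsto (fun β => BHC.childDissim E P hs X lam β T₀) Filter.atTop (nhds 0) →
        Filter.Tendsto (fun β => BHC.childDissim E P hs X lam β T₁) Filter.atTop (nhds 0) →
        BHC.dStar E X T₀.cluster T₁.cluster < lam →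
        Filter.Tendsto (fun β => BHC.dissim E P hs X lam β T₀ T₁) Filter.atTop (nhds 0)) ∧
      (lam < BHC.dStar E X T₀.cluster T₁.cluster →
        Filter.Tendsto (fun β => BHC.dissim E P hs X lam β T₀ T₁)
          Filter.atTop Filter.atTop)) ∧
    -- the condition on the children holds in trees all of whose merges are below the threshold
    (∀ T : BHC.ClusterTree n, T.Valid →
      T.AllMerges (fun c₀ c₁ => BHC.dStar E X c₀ c₁ < lam) →
      Filter.Tendsto (fun β => BHC.childDissim E P hs X lam β T) Filter.atTop (nhds 0)) ∧
    -- comparison of two dissimilarities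
    (∀ T₀ T₁ T₂ T₃ : BHC.ClusterTree n, T₀.Valid → T₁.Valid → T₂.Valid → T₃.Valid →
      Disjoint T₀.cluster T₁.cluster → Disjoint T₂.cluster T₃.cluster →
      (∀ T ∈ [T₀, T₁, T₂, T₃],
        Filter.Tendsto (fun β => BHC.childDissim E P hs X lam β T) Filter.atTop (nhds 0)) →
      (BHC.dStar E X T₀.cluster T₁.cluster < BHC.dStar E X T₂.cluster T₃.cluster →
        Filter.Tendsto
          (fun β => BHC.dissim E P hs X lam β T₀ T₁ / BHC.dissim E P hs X lam β T₂ T₃)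
          Filter.atTop (nhds 0)) ∧
      (BHC.dStar E X T₂.cluster T₃.cluster < BHC.dStar E X T₀.cluster T₁.cluster →
        Filter.Tendsto
          (fun β => BHC.dissim E P hs X lam β T₀ T₁ / BHC.dissim E P hs X lam β T₂ T₃)
          Filter.atTop Filter.atTop)) ∧
    -- reduction to the greedy algorithm with `d⋆` and threshold `λ`
    ((∀ F T₀ T₁, BHC.GreedyReach (BHC.dStarTree E X) lam F →
        BHC.IsClosestPair (BHC.dStarTree E X) F T₀ T₁ → BHC.dStarTree E X T₀ T₁ ≠ lam) →
      (∀ᶠ β : ℝ in Filter.atTop, ∀ F : Set (BHC.ClusterTree n),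
        (BHC.GreedyReach (BHC.dissim E P hs X lam β) 1 F →
          BHC.GreedyReach (BHC.dStarTree E X) lam F) ∧
        (BHC.GreedyOutput (BHC.dissim E P hs X lam β) 1 F →
          BHC.GreedyOutput (BHC.dStarTree E X) lam F)) ∧
      ((∀ F T₀ T₁ S₀ S₁, BHC.GreedyReach (BHC.dStarTree E X) lam F →
          BHC.IsClosestPair (BHC.dStarTree E X) F T₀ T₁ →
          BHC.IsClosestPair (BHC.dStarTree E X) F S₀ S₁ →
          BHC.dStarTree E X T₀ T₁ ≤ lam →
          (S₀ = T₀ ∧ S₁ = T₁) ∨ (S₀ = T₁ ∧ S₁ = T₀)) →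
        ∀ᶠ β : ℝ in Filter.atTop, ∀ F : Set (BHC.ClusterTree n),
          (BHC.GreedyReach (BHC.dissim E P hs X lam β) 1 F ↔
            BHC.GreedyReach (BHC.dStarTree E X) lam F) ∧
          (BHC.GreedyOutput (BHC.dissim E P hs X lam β) 1 F ↔
            BHC.GreedyOutput (BHC.dStarTree E X) lam F))) := by
  refine ⟨fun T₀ T₁ _ _ hd => ⟨BHC.tendsto_dissim_zero P hs X hX lam hd,
      BHC.tendsto_dissim_atTop P hs X hX lam hd⟩,
    BHC.tendsto_childDissim_of_allMerges P hs X hX lam,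
    fun T₀ T₁ T₂ T₃ _ _ _ _ h01 h23 hC => ?_, fun htie => ?_⟩
  · have hpos := BHC.eventually_dissim_div_dissim_pos P hs X hX lam T₀ T₁ T₂ T₃
    have hlim := BHC.tendsto_log_dissim_div_dissim P hs X hX lam h01 h23 hC
    exact ⟨fun h => BHC.tendsto_zero_of_log_div (sub_neg.2 h) hpos hlim,
      fun h => BHC.tendsto_atTop_of_log_div (sub_pos.2 h) hpos hlim⟩
  · have hforest : ∀ F, BHC.GreedyReach (BHC.dStarTree E X) lam F →
        BHC.IsForest (fun c₀ c₁ => BHC.dStar E X c₀ c₁ < lam) F := fun F hF =>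
      hF.isForest (p := fun c₀ c₁ => BHC.dStar E X c₀ c₁ < lam) fun G T₀ T₁ hG hc hle =>
        lt_of_le_of_ne hle (htie G T₀ T₁ hG hc)
    have hfin : ∀ F, BHC.GreedyReach (BHC.dStarTree E X) lam F → F.Finite :=
      fun F hF => (hforest F hF).finite
    refine ⟨?_, fun huniq => ?_⟩
    · filter_upwards [BHC.eventually_refines P hs X hX lam] with β hβ F
      have href := fun G hG => hβ G (hforest G hG)
      exact ⟨BHC.greedyReach_of_refines href, BHC.greedyOutput_of_refines href hfin htie⟩
    · filter_upwards [BHC.eventually_refines P hs X hX lam] with β hβ F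
      have href := fun G hG => hβ G (hforest G hG)
      have hreach : ∀ G, BHC.GreedyReach (BHC.dStarTree E X) lam G →
          BHC.GreedyReach (BHC.dissim E P hs X lam β) 1 G := fun G =>
        BHC.greedyReach_of_refines_of_unique href hfin htie huniq
          (BHC.dissim_comm E P hs X lam β)
      exact ⟨⟨BHC.greedyReach_of_refines href, hreach F⟩,
        BHC.greedyOutput_of_refines href hfin htie,
        fun hF => ⟨hreach F hF.1, fun F' hstep => hF.2 F' ((href F hF.1).greedyStep hstep)⟩⟩
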